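/- Let $k$ be an algebraically closed field, $r\ge 0$ an integer, and $A=k[y_1,\dots,y_r]$, graded with every $y_i$ of degree $-1$. A free $DG$-$A$-module is a $\mathbb Z$-graded $A$-module $M$, free as an $A$-module, with an $A$-linear endomorphism $\partial$ of degree $-1$ such that $\partial^2=0$. For $n\ge 1$, $N=2n$ and a nonincreasing $N$-tuple of integers $d=(d_1,\dots,d_N)$, let $k^*$ act on the strictly upper triangular $N\times N$ matrices over $k$ by $\lambda\cdot(x_{ij})=(\lambda^{d_i-d_j+1}x_{ij})$, let $U(d)$ be the quotient of the set of nonzero such matrices by this action, let $V(d)\subseteq U(d)$ be the set of classes of matrices of square zero, and let $L(d)\subseteq V(d)$ be the set of classes of matrices of rank less than $n$. A nonconstant morphism $\psi:\mathbb P^{r-1}_k\to V(d)-L(d)$ is a map with values in $V(d)-L(d)$ such that, for some integer $m\ge 1$, it is represented by a strictly upper triangular matrix $(\psi_{ij})$ of polynomials in $k[x_1,\dots,x_r]$ (with $\deg x_i=1$), where $\psi_{ij}$ is homogeneous of degree $m(d_i-d_j+1)$ for $i<j$, and where at every point of $\mathbb P^{r-1}_k$ some $\psi_{ij}$ does not vanish.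 Consider the following two statements. * $\mathrm{SZ}(k,r,N)$, for $N=2n$ (square-zero matrix conjecture): if for some nonincreasing $d$ there is a nonconstant morphism $\mathbb P^{r-1}_k\to V(d)-L(d)$, then $N\ge 2^r$. * $\mathrm{C}(k,r,N)$, for $N\ge 1$ (Carlsson's rank conjecture): if a free $DG$-$A$-module of rank $N$ has nonzero homology that is finite dimensional over $k$, then $N\ge 2^r$. **Theorem.** (1) For every $N\ge 1$, if $\mathrm{SZ}(k,r,N')$ holds for all even $N'$ with $2\le N'\le N$, then $\mathrm{C}(k,r,N)$ holds. In particular, the square-zero matrix conjecture implies Carlsson's rank conjecture. (2) Suppose $r\ge 1$, and let $(M,\partial)$ be a free $DG$-$A$-module with nonzero homology that is finite dimensional over $k$, whose rank $N$ is the smallest positive integer that is the rank of such a $DG$-$A$-module. Then $\partial(M)\subseteq (y_1,\dots,y_r)M$ and $N=2n$ is even. Moreover, there is a basis $b_1,\dots,b_N$ of $M$ with each $b_i$ homogeneous, of degree $-d_i$, where $d_1\ge\dots\ge d_N$, such that the matrix $\Psi=(\Psi_{ij})$ defined by $\partial(b_i)=\sum_j\Psi_{ij}b_j$ is strictly upper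 triangular, its evaluation at every $\gamma\in k^r-\{0\}$ has rank $n$, and $\Psi$ (with $y_i$ replaced by $x_i$) represents, with $m=1$, a nonconstant morphism $\mathbb P^{r-1}_k\to V(d)-L(d)$. -/

import Mathlib

universe u v

namespace RankConjecture

/-! ### Differential graded modules -/

/-- The structure of a differential graded module on the module `M` over the `ℤ`-graded ring
`(R, 𝒜)`: a grading `M = ⨁ j, piece j` making `M` a graded `R`-module, together with an `R`-linear
endomorphism `diff` of degree `-1` and square zero. -/
structure DGModule {R : Type*} [CommRing R] {σ : Type*} [SetLike σ R] [AddSubmonoidClass σ R]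
    (𝒜 : ℤ → σ) [GradedRing 𝒜] (M : Type*) [AddCommGroup M] [Module R M] where
  /-- The homogeneous elements of degree `j`. -/
  piece : ℤ → AddSubgroup M
  isInternal : DirectSum.IsInternal piece
  smul_mem : ∀ ⦃i j : ℤ⦄ ⦃a : R⦄ ⦃x : M⦄, a ∈ 𝒜 i → x ∈ piece j → a • x ∈ piece (i + j)
  /-- The differential. -/
  diff : M →ₗ[R] M
  diff_mem : ∀ ⦃j : ℤ⦄ ⦃x : M⦄, x ∈ piece j → diff x ∈ piece (j - 1)
  diff_comp_diff : diff ∘ₗ diff = 0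

namespace DGModule

variable {R : Type*} [CommRing R] {σ : Type*} [SetLike σ R] [AddSubmonoidClass σ R]
  {𝒜 : ℤ → σ} [GradedRing 𝒜] {M : Type*} [AddCommGroup M] [Module R M]

/-- The homology `ker ∂ / im ∂`, an `R`-module. -/
abbrev Homology (D : DGModule 𝒜 M) : Type _ :=
  LinearMap.ker D.diff ⧸ (LinearMap.range D.diff).submoduleOf (LinearMap.ker D.diff)

end DGModule

/-- The polynomial algebra `A = k[y₁, …, y_r]`. -/
abbrev PolyAlg (k : Type u) [Field k] (r : ℕ) : Type u := MvPolynomial (Fin r) k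

/-- The grading of `A = k[y₁, …, y_r]` in which every `y_i` has degree `-1`. -/
noncomputable abbrev polyGrading (k : Type u) [Field k] (r : ℕ) :
    ℤ → Submodule k (PolyAlg k r) :=
  MvPolynomial.weightedHomogeneousSubmodule k (fun _ : Fin r => (-1 : ℤ))

noncomputable instance polyGradedRing (k : Type u) [Field k] (r : ℕ) :
    GradedRing (polyGrading k r) :=
  MvPolynomial.weightedGradedAlgebra k (fun _ : Fin r => (-1 : ℤ))

/-- The homology is nonzero, and finite dimensional as a `k`-vector space. -/
def HasNonzeroFiniteHomology {k : Type u} [Field k] {r : ℕ}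
    {M : Type v} [AddCommGroup M] [Module (PolyAlg k r) M]
    (D : DGModule (polyGrading k r) M) : Prop :=
  Nontrivial D.Homology ∧ Module.Finite k (RestrictScalars k (PolyAlg k r) D.Homology)

/-- Carlsson's rank conjecture for the field `k`, for `r` variables and for rank `N`: if a free
`DG`-`A`-module of positive rank `N` has nonzero homology that is finite dimensional over `k`, then
`N ≥ 2 ^ r`. -/
def CarlssonRankConjecture (k : Type u) [Field k] (r N : ℕ) : Prop :=
  ∀ (M : Type v) [AddCommGroup M] [Module (PolyAlg k r) M] [Module.Free (PolyAlg k r) M]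
    (D : DGModule (polyGrading k r) M),
    0 < N → Module.finrank (PolyAlg k r) M = N → HasNonzeroFiniteHomology D → 2 ^ r ≤ N

/-- `N` is the smallest (positive, finite) rank of a free `DG`-`A`-module whose homology is nonzero
and finite dimensional over `k`. (For infinite rank, `finrank` is `0`.) -/
def IsSmallestRank (k : Type u) [Field k] (r N : ℕ) : Prop :=
  IsLeast {N' : ℕ | 0 < N' ∧ ∃ (M : Type v) (_ : AddCommGroup M) (_ : Module (PolyAlg k r) M)
    (D : DGModule (polyGrading k r) M), Module.Free (PolyAlg k r) M ∧
      Module.finrank (PolyAlg k r) M = N' ∧ HasNonzeroFiniteHomology D} N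

/-! ### Varieties of square-zero matrices -/

section Varieties

variable {k : Type u} [Field k] {r n : ℕ}

/-- The points of `U_N - {0}`: the nonzero strictly upper triangular `N × N` matrices. -/
abbrev PuncturedU (k : Type u) [Field k] (N : ℕ) : Type u :=
  {X : Matrix (Fin N) (Fin N) k // (∀ i j, j ≤ i → X i j = 0) ∧ X ≠ 0}

/-- The orbit relation on `U_N - {0}` of the action
`c • (x_ij) = (c ^ (d_i - d_j + 1) * x_ij)` of `kˣ`. -/
def weightedSetoid {N : ℕ} (d : Fin N → ℤ) : Setoid (PuncturedU k N) where
  r X Y := ∃ c : kˣ, ∀ i j, Y.1 i j = ((c ^ (d i - d j + 1) : kˣ) : k) * X.1 i j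
  iseqv :=
    { refl := fun X => ⟨1, fun i j => by simp⟩
      symm := by
        rintro X Y ⟨c, h⟩
        refine ⟨c⁻¹, fun i j => ?_⟩
        rw [h, ← mul_assoc, ← Units.val_mul, inv_zpow, inv_mul_cancel, Units.val_one, one_mul]
      trans := by
        rintro X Y Z ⟨c, h⟩ ⟨c', h'⟩
        refine ⟨c' * c, fun i j => ?_⟩
        rw [h', h, ← mul_assoc, ← Units.val_mul, mul_zpow] }

/-- The points of the weighted projective space `U(d) = (U_N - {0}) / kˣ`. -/
abbrev WeightedU (k : Type u) [Field k] {N : ℕ} (d : Fin N → ℤ) : Type u :=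
  Quotient (weightedSetoid (k := k) d)

/-- The projective variety `V(d) ⊆ U(d)` of square-zero matrices. -/
def varV (k : Type u) [Field k] {N : ℕ} (d : Fin N → ℤ) : Set (WeightedU k d) :=
  {x | ∃ X : PuncturedU k N, X.1 * X.1 = 0 ∧ x = Quotient.mk (weightedSetoid d) X}

/-- For `N = 2n`, the subvariety `L(d) ⊆ V(d)` of matrices of rank less than `n`. -/
def varL (k : Type u) [Field k] (d : Fin (2 * n) → ℤ) : Set (WeightedU k d) :=
  {x | ∃ X : PuncturedU k (2 * n), X.1 * X.1 = 0 ∧ X.1.rank < n ∧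
    x = Quotient.mk (weightedSetoid d) X}

/-- The map `ψ` from `ℙ^{r-1}` to `U(d)` is represented by the strictly upper triangular matrix
`(ψ_ij)` of homogeneous polynomials of degrees `m (d_i - d_j + 1)` in `x₁, …, x_r` (each of
degree `1`), not all of which vanish at any one point of `ℙ^{r-1}`. -/
structure Represents {N : ℕ} (d : Fin N → ℤ) (m : ℕ)
    (Ψ : Matrix (Fin N) (Fin N) (MvPolynomial (Fin r) k))
    (ψ : Projectivization k (Fin r → k) → WeightedU k d) : Prop where
  strictUpper : ∀ i j, j ≤ i → Ψ i j = 0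
  homogeneous : ∀ i j, i < j →
    MvPolynomial.IsWeightedHomogeneous (fun _ : Fin r => (1 : ℤ)) (Ψ i j) (m * (d i - d j + 1))
  nonvanishing : ∀ γ : Fin r → k, γ ≠ 0 → ∃ i j, i < j ∧ MvPolynomial.eval γ (Ψ i j) ≠ 0
  value : ∀ (γ : Fin r → k) (hγ : γ ≠ 0),
    ∃ h : (∀ i j, j ≤ i → Ψ.map (MvPolynomial.eval γ) i j = 0) ∧ Ψ.map (MvPolynomial.eval γ) ≠ 0,
      ψ (Projectivization.mk k γ hγ) =
        Quotient.mk (weightedSetoid d) ⟨Ψ.map (MvPolynomial.eval γ), h⟩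

/-- `ψ` is a nonconstant morphism from `ℙ^{r-1}` to the subset `W` of `U(d)`. -/
def IsNonconstantMorphism {N : ℕ} (d : Fin N → ℤ) (W : Set (WeightedU k d))
    (ψ : Projectivization k (Fin r → k) → WeightedU k d) : Prop :=
  (∀ x, ψ x ∈ W) ∧
    ∃ (m : ℕ) (Ψ : Matrix (Fin N) (Fin N) (MvPolynomial (Fin r) k)), 0 < m ∧ Represents d m Ψ ψ

end Varieties

/-- The square-zero-matrix conjecture for the field `k`, for `r` variables and for `N = 2n`: if for
some nonincreasing `d` there is a nonconstant morphism `ℙ^{r-1} → V(d) - L(d)`, then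
`N ≥ 2 ^ r`. -/
def SquareZeroMatrixConjecture (k : Type u) [Field k] (r n : ℕ) : Prop :=
  ∀ d : Fin (2 * n) → ℤ, Antitone d →
    (∃ ψ : Projectivization k (Fin r → k) → WeightedU k d,
      IsNonconstantMorphism d (varV k d \ varL k d) ψ) →
    2 ^ r ≤ 2 * n

end RankConjecture

/-! A free `DG`-module of smallest rank is shown to be given, in a suitable homogeneous basis, by a
strictly upper triangular matrix; the rank conjecture then follows by applying the matrix conjecture
to that smallest rank.

A finite free graded module has a homogeneous basis, by Nakayama (`exists_homogeneous_basis`). If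
the differential had a unit entry, a contractible summand of rank two would split off, leaving
smaller rank and the same kind of homology; so by minimality all entries lie in the ideal of the
variables (`constantCoeff_repr_diff_eq_zero`).

Order the basis by degree. An entry on or below the diagonal then has polynomial degree at most one,
so only its linear part can survive. Comparing quadratic terms in `Ψ * Ψ = 0` shows that the
coefficient matrices of the variables square to zero and anticommute. Such operators are
simultaneously strictly triangular in a homogeneous basis (`exists_homogeneous_triangular_basis`),
and passing to it makes `Ψ` strictly upper triangular (`exists_strictUpper_basis`).

Finite dimensional homology is killed by a power of each variable. For a triangular differential
this upgrades to a null-homotopy of a higher power (`exists_homotopy`). Evaluated at a point where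
the variable is nonzero, the homotopy contracts the evaluated matrix, which forces its rank to be
half its size (`two_mul_rank_diffMatrix`). Homogeneity of the entries then gives the morphism. -/

namespace RankConjecture

namespace DGModule

/-! ### Homogeneous components of a graded module. -/

section Components

variable {R : Type*} [CommRing R] {σ : Type*} [SetLike σ R] [AddSubmonoidClass σ R]
  {𝒜 : ℤ → σ} [GradedRing 𝒜] {M : Type*} [AddCommGroup M] [Module R M]

/-- The projection of `M` onto its homogeneous component of degree `t`. -/
noncomputable def comp (D : DGModule 𝒜 M) (t : ℤ) : M →+ M :=
  letI := D.isInternal.chooseDecomposition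
  (D.piece t).subtype.comp
    ((DFinsupp.evalAddMonoidHom t).comp (DirectSum.decomposeAddEquiv D.piece).toAddMonoidHom)

theorem comp_mem (D : DGModule 𝒜 M) (t : ℤ) (x : M) : D.comp t x ∈ D.piece t := by
  simp [comp]

theorem comp_of_mem (D : DGModule 𝒜 M) {t : ℤ} {x : M} (hx : x ∈ D.piece t) :
    D.comp t x = x := by
  let := D.isInternal.chooseDecomposition
  exact DirectSum.decompose_of_mem_same D.piece hx

theorem comp_of_mem_ne (D : DGModule 𝒜 M) {s t : ℤ} {x : M} (hx : x ∈ D.piece s) (h : s ≠ t) :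
    D.comp t x = 0 := by
  let := D.isInternal.chooseDecomposition
  exact DirectSum.decompose_of_mem_ne D.piece hx h

/-- An additive property holding for homogeneous elements holds for all elements. -/
theorem homogeneous_induction (D : DGModule 𝒜 M) {P : M → Prop} (zero : P 0)
    (hom : ∀ t, ∀ x ∈ D.piece t, P x) (add : ∀ x y, P x → P y → P (x + y)) (x : M) : P x := by
  let := D.isInternal.chooseDecomposition
  exact DirectSum.Decomposition.inductionOn D.piece zero (fun m => hom _ _ m.2) add x

/-- A property closed under addition holds for `x` if it holds for the components of `x`. -/
theorem of_comp (D : DGModule 𝒜 M) {P : M → Prop} (zero : P 0)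
    (add : ∀ x y, P x → P y → P (x + y)) (x : M) (hom : ∀ t, P (D.comp t x)) : P x := by
  classical
  let := D.isInternal.chooseDecomposition
  rw [← DirectSum.sum_support_decompose D.piece x]
  exact Finset.sum_induction _ P add zero fun t _ => hom t

theorem comp_diff (D : DGModule 𝒜 M) (t : ℤ) (x : M) :
    D.comp (t - 1) (D.diff x) = D.diff (D.comp t x) := by
  induction x using D.homogeneous_induction with
  | zero => simp
  | hom s x hx =>
    by_cases h : s = t
    · subst h
      rw [D.comp_of_mem hx, D.comp_of_mem (D.diff_mem hx)]
    · rw [D.comp_of_mem_ne hx h, D.comp_of_mem_ne (D.diff_mem hx) (by omega), map_zero]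
  | add x y hx hy => simp [hx, hy]

theorem diff_diff (D : DGModule 𝒜 M) (x : M) : D.diff (D.diff x) = 0 :=
  LinearMap.congr_fun D.diff_comp_diff x

/-- Additive subgroups that admit a compatible family of projections form a grading. -/
theorem _root_.RankConjecture.isInternal_of_projections {Q : Type*} [AddCommGroup Q]
    (piece : ℤ → AddSubgroup Q) (p : ℤ → Q →+ Q)
    (same : ∀ t, ∀ x ∈ piece t, p t x = x)
    (ne : ∀ s t, s ≠ t → ∀ x ∈ piece s, p t x = 0) (top : ∀ x, x ∈ ⨆ t, piece t) :
    DirectSum.IsInternal piece := by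
  classical
  constructor
  · refine (injective_iff_map_eq_zero (DirectSum.coeAddMonoidHom piece)).2 fun x hx => ?_
    -- The projections recover every component from the sum, which gives injectivity.
    have key : ∀ (t : ℤ) (x : DirectSum ℤ fun t => piece t),
        p t (DirectSum.coeAddMonoidHom piece x) = x t := by
      intro t x
      induction x using DirectSum.induction_on with
      | zero => simp
      | of s x =>
        rw [DirectSum.coeAddMonoidHom_of]
        by_cases h : s = t
        · subst h
          rw [same _ _ x.2, DirectSum.of_eq_same]
        · rw [ne _ _ h _ x.2, DirectSum.of_eq_of_ne _ _ _ (Ne.symm h)]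
          rfl
      | add x y hx hy => simp [hx, hy]
    ext t
    rw [← key, hx, map_zero]
    rfl
  · intro x
    have h : ⨆ t, piece t ≤ (DirectSum.coeAddMonoidHom piece).range := iSup_le fun t y hy =>
      ⟨DirectSum.of (fun t => piece t) t ⟨y, hy⟩, DirectSum.coeAddMonoidHom_of _ _ _⟩
    exact h (top x)

end Components

/-! ### Homogeneous bases over the polynomial ring. -/

section Poly

variable {k : Type u} [Field k] {r : ℕ} {M : Type v} [AddCommGroup M] [Module (PolyAlg k r) M]

/-- The homogeneous component of degree `t` of a polynomial, each variable having degree `-1`. -/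
noncomputable abbrev _root_.RankConjecture.polyComp (k : Type u) [Field k] (r : ℕ) (t : ℤ) :
    PolyAlg k r →ₗ[k] PolyAlg k r :=
  MvPolynomial.weightedHomogeneousComponent (fun _ : Fin r => (-1 : ℤ)) t

theorem comp_smul (D : DGModule (polyGrading k r) M) {s : ℤ} (t : ℤ) (a : PolyAlg k r) {x : M}
    (hx : x ∈ D.piece s) : D.comp t (a • x) = polyComp k r (t - s) a • x := by
  induction a using DirectSum.Decomposition.inductionOn (polyGrading k r) with
  | zero => simp
  | @homogeneous i a =>
    have ha := D.smul_mem a.2 hx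
    by_cases h : i = t - s
    · subst h
      rw [sub_add_cancel] at ha
      rw [D.comp_of_mem ha, polyComp,
        MvPolynomial.weightedHomogeneousComponent_of_mem a.2, if_pos rfl]
    · rw [D.comp_of_mem_ne ha (by omega), polyComp,
        MvPolynomial.weightedHomogeneousComponent_of_mem a.2, if_neg (Ne.symm h), zero_smul]
  | add a b ha hb => simp [add_smul, ha, hb]

/-- The weight of a monomial when each variable has degree `-1`. -/
theorem _root_.RankConjecture.weight_neg_one (m : Fin r →₀ ℕ) :
    Finsupp.weight (fun _ : Fin r => (-1 : ℤ)) m = -(m.degree : ℤ) := by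
  simp [Finsupp.weight_apply, Finsupp.sum, Finsupp.degree_apply]

theorem _root_.RankConjecture.polyComp_zero (a : PolyAlg k r) :
    polyComp k r 0 a = MvPolynomial.C (MvPolynomial.constantCoeff a) := by
  ext m
  rw [MvPolynomial.coeff_weightedHomogeneousComponent, MvPolynomial.coeff_C,
    MvPolynomial.constantCoeff_eq]
  rw [weight_neg_one]
  by_cases h : m = 0
  · subst h
    simp
  · rw [if_neg, if_neg (Ne.symm h)]
    have := (Finsupp.degree_eq_zero_iff m).not.2 h
    omega

/-- The coordinates of the components in a homogeneous basis. -/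
theorem repr_comp (D : DGModule (polyGrading k r) M) {ι : Type*} [Fintype ι]
    (b : Module.Basis ι (PolyAlg k r) M) (δ : ι → ℤ) (hb : ∀ i, b i ∈ D.piece (δ i)) (t : ℤ)
    (x : M) (i : ι) : b.repr (D.comp t x) i = polyComp k r (t - δ i) (b.repr x i) := by
  classical
  conv_lhs => rw [← b.sum_repr x]
  simp only [map_sum, D.comp_smul t _ (hb _), map_smul, Module.Basis.repr_self,
    Finsupp.coe_finsetSum, Finset.sum_apply, Finsupp.smul_apply, smul_eq_mul,
    Finsupp.single_apply, mul_ite, mul_one, mul_zero, Finset.sum_ite_eq', Finset.mem_univ, if_true]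

theorem repr_mem (D : DGModule (polyGrading k r) M) {ι : Type*} [Fintype ι]
    (b : Module.Basis ι (PolyAlg k r) M) (δ : ι → ℤ) (hb : ∀ i, b i ∈ D.piece (δ i)) {t : ℤ}
    {x : M} (hx : x ∈ D.piece t) (i : ι) : b.repr x i ∈ polyGrading k r (t - δ i) := by
  rw [← D.comp_of_mem hx, D.repr_comp b δ hb]
  exact MvPolynomial.weightedHomogeneousComponent_mem _ _ _

theorem _root_.RankConjecture.mem_span_X_iff (a : PolyAlg k r) :
    a ∈ Ideal.span (Set.range (MvPolynomial.X : Fin r → PolyAlg k r)) ↔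
      MvPolynomial.constantCoeff a = 0 := by
  rw [← Set.image_univ, MvPolynomial.mem_ideal_span_X_image, MvPolynomial.constantCoeff_eq]
  constructor
  · intro h
    by_contra h0
    obtain ⟨i, -, hi⟩ := h 0 (MvPolynomial.mem_support_iff.2 h0)
    exact hi rfl
  · intro h m hm
    by_contra! hc
    have : m = 0 := by
      ext i
      exact hc i trivial
    subst this
    exact MvPolynomial.mem_support_iff.1 hm h

/-- A free module of finite rank with a grading has a homogeneous basis. -/
theorem exists_homogeneous_basis (D : DGModule (polyGrading k r) M)
    [Module.Free (PolyAlg k r) M] [Module.Finite (PolyAlg k r) M] :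
    ∃ (b : Module.Basis (Fin (Module.finrank (PolyAlg k r) M)) (PolyAlg k r) M)
      (δ : Fin (Module.finrank (PolyAlg k r) M) → ℤ), ∀ i, b i ∈ D.piece (δ i) := by
  classical
  set N := Module.finrank (PolyAlg k r) M
  let e : Module.Basis (Fin N) (PolyAlg k r) M := Module.finBasis _ _
  -- Reduction modulo the ideal of the variables, read in a basis that need not be homogeneous.
  let ε : M →+ (Fin N → k) :=
    { toFun := fun x i => MvPolynomial.constantCoeff (e.repr x i)
      map_zero' := by ext; simp
      map_add' := fun x y => by ext; simp }
  have ε_smul : ∀ (a : PolyAlg k r) x, ε (a • x) = MvPolynomial.constantCoeff a • ε x := by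
    intro a x
    ext i
    simp [ε]
  have ε_surj : Function.Surjective ε := by
    intro v
    refine ⟨∑ i, (MvPolynomial.C (v i) : PolyAlg k r) • e i, ?_⟩
    ext i
    simp [ε, Finsupp.single_apply, apply_ite]
  let I := Ideal.span (Set.range (MvPolynomial.X : Fin r → PolyAlg k r))
  have ε_ker : ∀ x, ε x = 0 → x ∈ I • (⊤ : Submodule (PolyAlg k r) M) := by
    intro x hx
    rw [← e.sum_repr x]
    refine Submodule.sum_mem _ fun i _ => Submodule.smul_mem_smul ?_ trivial
    exact (mem_span_X_iff _).2 (congrFun hx i)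
  let S : Set (Fin N → k) := {v | ∃ t, ∃ x ∈ D.piece t, ε x = v}
  have hS : Submodule.span k S = ⊤ := by
    rw [eq_top_iff]
    intro v _
    obtain ⟨x, rfl⟩ := ε_surj v
    induction x using D.homogeneous_induction with
    | zero => simp
    | hom t x hx => exact Submodule.subset_span ⟨t, x, hx, rfl⟩
    | add x y hx hy =>
      rw [map_add]
      exact Submodule.add_mem _ (hx trivial) (hy trivial)
  -- Reductions of homogeneous elements span, so a basis of the reduction can be chosen among them;
  -- their lifts will be the homogeneous basis.
  obtain ⟨f, hf, hspan, -⟩ := Submodule.exists_fun_fin_finrank_span_eq k S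
  have hrank : Module.finrank k (Submodule.span k S) = N := by
    rw [hS, finrank_top, Module.finrank_fin_fun]
  revert f
  rw [hrank]
  intro f hf hspan
  choose δ x hx hxf using hf
  have hgen : (⊤ : Submodule (PolyAlg k r) M) ≤
      Submodule.span (PolyAlg k r) (Set.range x) ⊔ I • ⊤ := by
    intro m _
    have hm : ε m ∈ Submodule.span k (Set.range f) := by
      rw [hspan, hS]
      trivial
    obtain ⟨c, hc⟩ := (Submodule.mem_span_range_iff_exists_fun k).1 hm
    have : m = ∑ i, (MvPolynomial.C (c i) : PolyAlg k r) • x i +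
        (m - ∑ i, (MvPolynomial.C (c i) : PolyAlg k r) • x i) := by
      abel
    rw [this]
    refine Submodule.add_mem_sup (Submodule.sum_mem _ fun i _ => Submodule.smul_mem _ _
      (Submodule.subset_span ⟨i, rfl⟩)) (ε_ker _ ?_)
    rw [map_sub, map_sum, ← hc]
    simp [ε_smul, hxf]
  -- The ring is not local, so Nakayama only puts `a • M` in the span, for some `a` with constant
  -- term 1.
  obtain ⟨a, ha, hle⟩ := Submodule.exists_sub_one_mem_and_smul_le_of_fg_of_le_sup
    (I := I) Module.Finite.fg_top le_top hgen
  have ha0 : MvPolynomial.constantCoeff a = 1 := by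
    have := (mem_span_X_iff _).1 ha
    rwa [map_sub, map_one, sub_eq_zero] at this
  have hcomp : ∀ m ∈ Submodule.span (PolyAlg k r) (Set.range x), ∀ t,
      D.comp t m ∈ Submodule.span (PolyAlg k r) (Set.range x) := by
    intro m hm t
    obtain ⟨c, rfl⟩ := (Submodule.mem_span_range_iff_exists_fun _).1 hm
    rw [map_sum]
    refine Submodule.sum_mem _ fun i _ => ?_
    rw [D.comp_smul t _ (hx i)]
    exact Submodule.smul_mem _ _ (Submodule.subset_span ⟨i, rfl⟩)
  have htop : (⊤ : Submodule (PolyAlg k r) M) ≤ Submodule.span (PolyAlg k r) (Set.range x) := by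
    intro m _
    induction m using D.homogeneous_induction with
    | zero => simp
    | hom t m hm =>
      -- The grading removes `a`: for `m` of degree `t`, the degree `t` component of `a • m` is `m`
      -- itself, and the span is stable under taking components.
      have := hcomp _ (hle (Submodule.smul_mem_pointwise_smul m a ⊤ trivial)) t
      rwa [D.comp_smul t a hm, sub_self, polyComp_zero, ha0, map_one, one_smul] at this
    | add y z hy hz => exact Submodule.add_mem _ (hy trivial) (hz trivial)
  refine ⟨Module.Basis.mk (linearIndependent_of_top_le_span_of_card_eq_finrank htop
    (Fintype.card_fin _)) htop, δ, fun i => ?_⟩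
  rw [Module.Basis.mk_apply]
  exact hx i

end Poly

end DGModule

end RankConjecture

namespace RankConjecture

namespace DGModule

/-! ### Quotients of differential graded modules. -/

section Quotient

variable {R : Type*} [CommRing R] {σ : Type*} [SetLike σ R] [AddSubmonoidClass σ R]
  {𝒜 : ℤ → σ} [GradedRing 𝒜] {M : Type*} [AddCommGroup M] [Module R M]

/-- The quotient of a differential graded module by a homogeneous submodule stable under the
differential. -/
noncomputable def quotient (D : DGModule 𝒜 M) (K : Submodule R M)
    (hd : K ≤ K.comap D.diff) (hc : ∀ t, ∀ x ∈ K, D.comp t x ∈ K) : DGModule 𝒜 (M ⧸ K) where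
  piece t := (D.piece t).map K.mkQ.toAddMonoidHom
  isInternal := by
    let p (t : ℤ) : M ⧸ K →+ M ⧸ K := QuotientAddGroup.lift K.toAddSubgroup
      (K.mkQ.toAddMonoidHom.comp (D.comp t))
      (fun x hx => (Submodule.Quotient.mk_eq_zero K).2 (hc t x hx))
    have hp : ∀ t x, p t (K.mkQ x) = K.mkQ (D.comp t x) := fun t x => rfl
    refine isInternal_of_projections _ p ?_ ?_ ?_
    · rintro t _ ⟨x, hx, rfl⟩
      exact (hp t x).trans (by rw [D.comp_of_mem hx]; rfl)
    · rintro s t h _ ⟨x, hx, rfl⟩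
      exact (hp t x).trans (by rw [D.comp_of_mem_ne hx h, map_zero])
    · intro x
      obtain ⟨x, rfl⟩ := K.mkQ_surjective x
      refine D.of_comp (P := fun x => K.mkQ x ∈ ⨆ t, (D.piece t).map K.mkQ.toAddMonoidHom)
        (by simp) (fun x y hx hy => ?_) x fun t => ?_
      · rw [map_add]
        exact add_mem hx hy
      · exact AddSubgroup.mem_iSup_of_mem t ⟨_, D.comp_mem t x, rfl⟩
  smul_mem := by
    rintro i j a _ ha ⟨x, hx, rfl⟩
    exact ⟨a • x, D.smul_mem ha hx, map_smul K.mkQ a x⟩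
  diff := K.mapQ K D.diff hd
  diff_mem := by
    rintro j _ ⟨x, hx, rfl⟩
    exact ⟨D.diff x, D.diff_mem hx, rfl⟩
  diff_comp_diff := by
    refine Submodule.linearMap_qext _ (LinearMap.ext fun x => ?_)
    change K.mkQ (D.diff (D.diff x)) = 0
    rw [D.diff_diff, map_zero]

theorem quotient_diff_mk (D : DGModule 𝒜 M) (K : Submodule R M)
    (hd : K ≤ K.comap D.diff) (hc : ∀ t, ∀ x ∈ K, D.comp t x ∈ K) (x : M) :
    (D.quotient K hd hc).diff (K.mkQ x) = K.mkQ (D.diff x) := rfl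

theorem homology_mk_eq_zero_iff (D : DGModule 𝒜 M) (x : LinearMap.ker D.diff) :
    (Submodule.Quotient.mk x : D.Homology) = 0 ↔ ∃ y, D.diff y = x := by
  rw [Submodule.Quotient.mk_eq_zero]
  rfl

theorem nontrivial_homology_iff (D : DGModule 𝒜 M) :
    Nontrivial D.Homology ↔ ∃ x, D.diff x = 0 ∧ ∀ y, D.diff y ≠ x := by
  constructor
  · intro h
    obtain ⟨q, hq⟩ := exists_ne (0 : D.Homology)
    obtain ⟨x, rfl⟩ := Submodule.Quotient.mk_surjective _ q
    rw [Ne, homology_mk_eq_zero_iff] at hq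
    exact ⟨x, x.2, fun y hy => hq ⟨y, hy⟩⟩
  · rintro ⟨x, hx, h⟩
    refine ⟨Submodule.Quotient.mk ⟨x, hx⟩, 0, ?_⟩
    rw [Ne, homology_mk_eq_zero_iff]
    rintro ⟨y, hy⟩
    exact h y hy

end Quotient

/-! ### Splitting off contractible summands, and minimality. -/

section Poly

variable {k : Type u} [Field k] {r : ℕ} {M : Type v} [AddCommGroup M] [Module (PolyAlg k r) M]

/-- Dividing by an acyclic submodule preserves the condition on homology. -/
theorem hasNonzeroFiniteHomology_quotient (D : DGModule (polyGrading k r) M)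
    (hD : HasNonzeroFiniteHomology D) (K : Submodule (PolyAlg k r) M)
    (hd : K ≤ K.comap D.diff) (hc : ∀ t, ∀ x ∈ K, D.comp t x ∈ K)
    (hK : ∀ x ∈ K, D.diff x = 0 → ∃ y ∈ K, D.diff y = x) :
    HasNonzeroFiniteHomology (D.quotient K hd hc) := by
  set D' := D.quotient K hd hc with hD'
  refine ⟨?_, ?_⟩
  · obtain ⟨x, hx, hxb⟩ := D.nontrivial_homology_iff.1 hD.1
    refine D'.nontrivial_homology_iff.2 ⟨K.mkQ x, ?_, ?_⟩
    · rw [hD', quotient_diff_mk, hx, map_zero]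
    · intro y hy
      obtain ⟨y, rfl⟩ := K.mkQ_surjective y
      rw [hD', quotient_diff_mk, ← sub_eq_zero, ← map_sub, Submodule.mkQ_apply,
        Submodule.Quotient.mk_eq_zero] at hy
      obtain ⟨z, -, hz⟩ := hK _ hy (by rw [map_sub, D.diff_diff, hx, sub_zero])
      refine hxb (y - z) ?_
      rw [map_sub, hz, sub_sub_cancel]
  · let f : LinearMap.ker D.diff →ₗ[PolyAlg k r] LinearMap.ker D'.diff :=
      K.mkQ.restrict fun x hx => by
        rw [LinearMap.mem_ker, hD', quotient_diff_mk, LinearMap.mem_ker.1 hx, map_zero]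
    let F : D.Homology →ₗ[PolyAlg k r] D'.Homology := Submodule.mapQ _ _ f (by
      rintro x ⟨y, hy⟩
      exact ⟨K.mkQ y, (D.quotient_diff_mk K hd hc y).trans (congrArg K.mkQ hy)⟩)
    -- A cycle of the quotient lifts to `x` with `D.diff x` in `K`; acyclicity of `K` supplies a
    -- correction in `K` making the lift a cycle.
    have hF : Function.Surjective F := by
      intro q
      obtain ⟨⟨x, hx⟩, rfl⟩ := Submodule.Quotient.mk_surjective _ q
      obtain ⟨x, rfl⟩ := K.mkQ_surjective x
      have hx' := hx
      rw [LinearMap.mem_ker, hD', quotient_diff_mk, Submodule.mkQ_apply,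
        Submodule.Quotient.mk_eq_zero] at hx'
      obtain ⟨z, hzK, hz⟩ := hK _ hx' (D.diff_diff x)
      refine ⟨Submodule.Quotient.mk ⟨x - z, ?_⟩, ?_⟩
      · rw [LinearMap.mem_ker, map_sub, hz, sub_self]
      · refine congrArg Submodule.Quotient.mk (Subtype.ext ?_)
        change K.mkQ (x - z) = K.mkQ x
        rw [map_sub, sub_eq_self]
        exact (Submodule.Quotient.mk_eq_zero K).2 hzK
    let G : RestrictScalars k (PolyAlg k r) D.Homology →ₗ[k]
        RestrictScalars k (PolyAlg k r) D'.Homology :=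
      { toFun := F
        map_add' := F.map_add
        map_smul' := fun c x => F.map_smul (algebraMap k (PolyAlg k r) c) x }
    have := hD.2
    exact Module.Finite.of_surjective G hF

/-- Replacing one basis vector by a vector whose coordinate there is a unit gives a basis. -/
theorem _root_.RankConjecture.exists_basis_update {R : Type*} [CommRing R] {M : Type*}
    [AddCommGroup M] [Module R M] {ι : Type*} [Fintype ι] [DecidableEq ι] (b : Module.Basis ι R M)
    (j : ι) (x : M) (hx : IsUnit (b.repr x j)) :
    ∃ b' : Module.Basis ι R M, ⇑b' = Function.update b j x := by
  have h := b.is_basis_iff_det (v := Function.update b j x)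
  -- This is Cramer's rule.
  have hdet : b.det (Function.update b j x) = b.repr x j := by
    have hmk : Module.Basis.mk b.linearIndependent b.span_eq.ge = b :=
      Module.Basis.eq_of_apply_eq (by simp)
    have := b.det_smul_mk_coord_eq_det_update b.linearIndependent b.span_eq.ge j
    rw [hmk, b.det_self, one_smul] at this
    exact (LinearMap.congr_fun this x).symm
  obtain ⟨h1, h2⟩ := h.2 (hdet ▸ hx)
  exact ⟨Module.Basis.mk h1 h2.ge, Module.Basis.coe_mk h1 h2.ge⟩

/-- A contractible summand of rank two can be split off. -/
theorem exists_rank_sub_two (D : DGModule (polyGrading k r) M) (hD : HasNonzeroFiniteHomology D)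
    {ι : Type} [Fintype ι] [DecidableEq ι] (b : Module.Basis ι (PolyAlg k r) M) (δ : ι → ℤ)
    (hb : ∀ i, b i ∈ D.piece (δ i)) {i j : ι} (hij : i ≠ j) (hdiff : D.diff (b i) = b j) :
    ∃ (M' : Type v) (_ : AddCommGroup M') (_ : Module (PolyAlg k r) M')
      (D' : DGModule (polyGrading k r) M'), Module.Free (PolyAlg k r) M' ∧
      Module.Finite (PolyAlg k r) M' ∧
      Module.finrank (PolyAlg k r) M' < Fintype.card ι ∧ HasNonzeroFiniteHomology D' := by
  -- Forgetting two coordinates: the kernel is spanned by `b i` and its boundary `b j`, hence is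
  -- acyclic, and the quotient is free on the remaining indices.
  let φ : M →ₗ[PolyAlg k r] ({s : ι // s ≠ i ∧ s ≠ j} → PolyAlg k r) :=
    LinearMap.pi fun s => b.coord s
  have hφ : Function.Surjective φ := by
    intro c
    refine ⟨∑ s : {s : ι // s ≠ i ∧ s ≠ j}, c s • b s, ?_⟩
    ext1 s
    simp [φ, Finsupp.single_apply, Subtype.coe_inj]
  have hmem : ∀ x, x ∈ LinearMap.ker φ ↔ ∀ s, s ≠ i → s ≠ j → b.repr x s = 0 := by
    intro x
    rw [LinearMap.mem_ker, funext_iff]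
    exact ⟨fun h s h1 h2 => h ⟨s, h1, h2⟩, fun h s => h s s.2.1 s.2.2⟩
  have hexp : ∀ x ∈ LinearMap.ker φ, x = b.repr x i • b i + b.repr x j • b j := by
    intro x hx
    conv_lhs => rw [← b.sum_repr x]
    refine Finset.sum_eq_add i j hij (fun s _ hs => ?_) (by simp) (by simp)
    rw [(hmem x).1 hx s hs.1 hs.2, zero_smul]
  have hbK : ∀ s, s = i ∨ s = j → b s ∈ LinearMap.ker φ := by
    intro s hs
    refine (hmem _).2 fun t h1 h2 => ?_
    rw [b.repr_self, Finsupp.single_eq_of_ne]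
    rintro rfl
    exact hs.elim h1 h2
  have hdj : D.diff (b j) = 0 := by rw [← hdiff, D.diff_diff]
  have hdx : ∀ x ∈ LinearMap.ker φ, D.diff x = b.repr x i • b j := by
    intro x hx
    conv_lhs => rw [hexp x hx, map_add, map_smul, map_smul, hdiff, hdj, smul_zero, add_zero]
  have hd : LinearMap.ker φ ≤ (LinearMap.ker φ).comap D.diff := by
    intro x hx
    rw [Submodule.mem_comap, hdx x hx]
    exact Submodule.smul_mem _ _ (hbK j (Or.inr rfl))
  have hc : ∀ t, ∀ x ∈ LinearMap.ker φ, D.comp t x ∈ LinearMap.ker φ := by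
    intro t x hx
    refine (hmem _).2 fun s h1 h2 => ?_
    rw [D.repr_comp b δ hb, (hmem x).1 hx s h1 h2, map_zero]
  have hK : ∀ x ∈ LinearMap.ker φ, D.diff x = 0 → ∃ y ∈ LinearMap.ker φ, D.diff y = x := by
    intro x hx h0
    have h1 : b.repr x i = 0 := by
      have := congrArg (fun z => b.repr z j) ((hdx x hx).symm.trans h0)
      simpa using this
    refine ⟨b.repr x j • b i, Submodule.smul_mem _ _ (hbK i (Or.inl rfl)), ?_⟩
    conv_rhs => rw [hexp x hx, h1, zero_smul, zero_add]
    rw [map_smul, hdiff]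
  let e := φ.quotKerEquivOfSurjective hφ
  refine ⟨M ⧸ LinearMap.ker φ, inferInstance, inferInstance, D.quotient _ hd hc,
    Module.Free.of_equiv e.symm, Module.Finite.equiv e.symm, ?_,
    D.hasNonzeroFiniteHomology_quotient hD _ hd hc hK⟩
  rw [e.finrank_eq, Module.finrank_fintype_fun_eq_card]
  exact Fintype.card_subtype_lt (x := i) (by simp)

/-- In a free `DG`-module of smallest rank, the differential has no unit coefficients. -/
theorem constantCoeff_repr_diff_eq_zero (D : DGModule (polyGrading k r) M)
    (hD : HasNonzeroFiniteHomology D) {N : ℕ} (hN : IsSmallestRank.{u, v} k r N)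
    (b : Module.Basis (Fin N) (PolyAlg k r) M) (δ : Fin N → ℤ)
    (hb : ∀ i, b i ∈ D.piece (δ i)) (i j : Fin N) :
    MvPolynomial.constantCoeff (b.repr (D.diff (b i)) j) = 0 := by
  by_contra hne
  have hmem := D.repr_mem b δ hb (D.diff_mem (hb i)) j
  -- A homogeneous entry with nonzero constant term has degree zero, hence is a nonzero scalar.
  have hδ : δ i - 1 - δ j = 0 := by
    by_contra h
    refine hne ?_
    rw [MvPolynomial.constantCoeff_eq]
    refine MvPolynomial.IsWeightedHomogeneous.coeff_eq_zero hmem 0 ?_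
    rw [map_zero]
    exact Ne.symm h
  rw [hδ] at hmem
  have hunit : IsUnit (b.repr (D.diff (b i)) j) := by
    have := polyComp_zero (b.repr (D.diff (b i)) j)
    rw [polyComp, MvPolynomial.weightedHomogeneousComponent_of_mem hmem, if_pos rfl] at this
    rw [this]
    exact (isUnit_iff_ne_zero.2 hne).map MvPolynomial.C
  have hij : i ≠ j := by
    rintro rfl
    omega
  -- Replacing `b j` by the boundary of `b i` exhibits the contractible pair and keeps the basis
  -- homogeneous.
  obtain ⟨b', hb'⟩ := exists_basis_update b j _ hunit
  have hb'i : b' i = b i := by rw [hb', Function.update_of_ne hij]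
  have hb'j : b' j = D.diff (b i) := by rw [hb', Function.update_self]
  have hb'mem : ∀ s, b' s ∈ D.piece (δ s) := by
    intro s
    by_cases hs : s = j
    · subst hs
      rw [hb'j, show δ s = δ i - 1 by omega]
      exact D.diff_mem (hb i)
    · rw [hb', Function.update_of_ne hs]
      exact hb s
  obtain ⟨M', _, _, D', hfree, hfin, hlt, hD'⟩ :=
    D.exists_rank_sub_two hD b' δ hb'mem hij (by rw [hb'i, hb'j])
  rw [Fintype.card_fin] at hlt
  refine hlt.not_ge (hN.2 ⟨?_, M', _, _, D', hfree, rfl, hD'⟩)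
  refine Nat.pos_of_ne_zero fun h0 => ?_
  have : Subsingleton M' := Module.finrank_zero_iff.1 h0
  obtain ⟨x, -, hx⟩ := D'.nontrivial_homology_iff.1 hD'.1
  exact hx 0 (Subsingleton.elim _ _)

end Poly

end DGModule

end RankConjecture

namespace RankConjecture

/-! ### Simultaneous triangularization of anticommuting square-zero operators. -/

section Triangular

variable {k V : Type*} [Field k] [AddCommGroup V] [Module k V]

/-- Anticommuting operators of square zero act as zero on some vector of any nonzero subquotient. -/
theorem exists_notMem_forall_apply_mem {κ : Type*} [Finite κ] (T : κ → V →ₗ[k] V)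
    (hsq : ∀ l v, T l (T l v) = 0) (hanti : ∀ l l' v, l ≠ l' → T l (T l' v) = -T l' (T l v))
    (W S : Submodule k V) (hW : ∀ l, ∀ v ∈ W, T l v ∈ W) (hS : ∀ l, ∀ v ∈ S, T l v ∈ S)
    (hWS : ¬W ≤ S) : ∃ v ∈ W, v ∉ S ∧ ∀ l, T l v ∈ S := by
  classical
  have := Fintype.ofFinite κ
  suffices h : ∀ s : Finset κ, ∃ v ∈ W, v ∉ S ∧ ∀ l ∈ s, T l v ∈ S by
    obtain ⟨v, hv, hvS, hl⟩ := h Finset.univ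
    exact ⟨v, hv, hvS, fun l => hl l (Finset.mem_univ l)⟩
  intro s
  induction s using Finset.induction_on with
  | empty =>
    obtain ⟨v, hv, hvS⟩ := SetLike.not_le_iff_exists.1 hWS
    exact ⟨v, hv, hvS, by simp⟩
  | insert l s hl ih =>
    obtain ⟨v, hv, hvS, h⟩ := ih
    by_cases hlv : T l v ∈ S
    · refine ⟨v, hv, hvS, fun l' hl' => ?_⟩
      obtain rfl | hl' := Finset.mem_insert.1 hl'
      · exact hlv
      · exact h l' hl'
    -- When `v` fails for `l`, its image works: `T l` squares to zero, and anticommutation preserves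
    -- the conditions already obtained.
    · refine ⟨T l v, hW l v hv, hlv, fun l' hl' => ?_⟩
      obtain rfl | hl'' := Finset.mem_insert.1 hl'
      · rw [hsq]
        exact S.zero_mem
      · rw [hanti l' l v (by rintro rfl; exact hl hl'')]
        exact S.neg_mem (hS l _ (h l' hl''))

/-- Anticommuting homogeneous operators of square zero on a graded vector space are simultaneously
strictly triangular in some homogeneous basis, ordered by degree. -/
theorem exists_homogeneous_triangular_basis [Module.Finite k V] {κ : Type*} [Finite κ]
    (T : κ → V →ₗ[k] V) (hsq : ∀ l v, T l (T l v) = 0)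
    (hanti : ∀ l l' v, l ≠ l' → T l (T l' v) = -T l' (T l v)) (Vg : ℤ → Submodule k V)
    (htop : ⨆ e, Vg e = ⊤) (hbdd : ∃ E, ∀ e, Vg e ≠ ⊥ → e ≤ E)
    (hT : ∀ l e, ∀ v ∈ Vg e, T l v ∈ Vg e) :
    ∃ (v : Module.Basis (Fin (Module.finrank k V)) k V) (δ : Fin (Module.finrank k V) → ℤ),
      Monotone δ ∧ (∀ i, v i ∈ Vg (δ i)) ∧
        ∀ l i, T l (v i) ∈ Submodule.span k (v '' Set.Ioi i) := by
  -- The basis is built from its last vector backwards. The final clause says that degrees above any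
  -- one used are already exhausted, which keeps `δ` monotone when a vector is prepended.
  suffices h : ∀ m ≤ Module.finrank k V, ∃ (v : Fin m → V) (δ : Fin m → ℤ),
      LinearIndependent k v ∧ Monotone δ ∧ (∀ i, v i ∈ Vg (δ i)) ∧
      (∀ l i, T l (v i) ∈ Submodule.span k (v '' Set.Ioi i)) ∧
      ∀ i e, δ i < e → Vg e ≤ Submodule.span k (Set.range v) by
    obtain ⟨v, δ, hli, hδ, hv, hTv, -⟩ := h _ le_rfl
    refine ⟨Module.Basis.mk hli
      (hli.span_eq_top_of_card_eq_finrank' (Fintype.card_fin _)).ge, δ, hδ, ?_, ?_⟩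
    · simpa using hv
    · simpa using hTv
  intro m
  induction m with
  | zero =>
    exact fun _ => ⟨Fin.elim0, Fin.elim0, linearIndependent_empty_type, fun i => i.elim0,
      fun i => i.elim0, fun _ i => i.elim0, fun i => i.elim0⟩
  | succ m ih =>
    intro hm
    obtain ⟨v, δ, hli, hδ, hv, hTv, hmax⟩ := ih (by omega)
    set S := Submodule.span k (Set.range v) with hSdef
    have hS : ∀ l, ∀ x ∈ S, T l x ∈ S := by
      intro l x hx
      have : S ≤ S.comap (T l) := by
        rw [hSdef, Submodule.span_le]
        rintro _ ⟨i, rfl⟩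
        exact Submodule.span_mono (Set.image_subset_range _ _) (hTv l i)
      exact this hx
    have hex : ∃ e, ¬Vg e ≤ S := by
      by_contra! hall
      have hStop : S = ⊤ := top_le_iff.1 (htop ▸ iSup_le hall)
      have := finrank_span_eq_card hli
      rw [← hSdef, hStop, finrank_top, Fintype.card_fin] at this
      omega
    obtain ⟨E, hE⟩ := hbdd
    -- The next vector is taken in the greatest degree not yet exhausted.
    obtain ⟨e, he, hemax⟩ := Int.exists_greatest_of_bdd
      ⟨E, fun e he => hE e fun h => he (h ▸ bot_le)⟩ hex
    obtain ⟨x, hx, hxS, hTx⟩ := exists_notMem_forall_apply_mem T hsq hanti (Vg e) S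
      (fun l => hT l e) hS he
    have hle : ∀ i, e ≤ δ i := by
      intro i
      by_contra! h
      exact he (hmax i e h)
    refine ⟨Fin.cons x v, Fin.cons e δ, linearIndependent_finCons.2 ⟨hli, hxS⟩, ?_, ?_, ?_, ?_⟩
    · intro i j hij
      induction i using Fin.cases with
      | zero =>
        induction j using Fin.cases with
        | zero => simp
        | succ j => simpa using hle j
      | succ i =>
        induction j using Fin.cases with
        | zero => exact absurd hij (by simp)
        | succ j => simpa using hδ (Fin.succ_le_succ_iff.1 hij)
    · intro i
      induction i using Fin.cases with
      | zero => simpa using hx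
      | succ i => simpa using hv i
    · intro l i
      induction i using Fin.cases with
      | zero =>
        refine Submodule.span_mono ?_ (hTx l)
        rintro _ ⟨j, rfl⟩
        exact ⟨j.succ, Fin.succ_pos j, by simp⟩
      | succ i =>
        rw [Fin.cons_succ]
        refine Submodule.span_mono ?_ (hTv l i)
        rintro _ ⟨j, hj, rfl⟩
        exact ⟨j.succ, Fin.succ_lt_succ_iff.2 hj, by simp⟩
    · have hsub : S ≤ Submodule.span k (Set.range (Fin.cons x v : Fin (m + 1) → V)) := by
        rw [Fin.range_cons]
        exact Submodule.span_mono (Set.subset_insert _ _)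
      have hgt : ∀ e', e < e' → Vg e' ≤ S := by
        intro e' h
        by_contra h'
        exact absurd (hemax e' h') (by omega)
      intro i e' h
      refine le_trans (hgt e' ?_) hsub
      induction i using Fin.cases with
      | zero => simpa using h
      | succ i => exact (hle i).trans_lt (by simpa using h)

end Triangular

/-! ### Linear parts and the quadratic terms of a product. -/

section QuadraticPart

variable {k : Type*} [Field k] {κ : Type*} [DecidableEq κ]

/-- Without constant terms, a quadratic monomial arises only as a product of two variables, in two
orders; these coincide when `l = l'`, hence the case distinction. -/
theorem coeff_mul_of_constantCoeff_eq_zero (p q : MvPolynomial κ k)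
    (hp : MvPolynomial.constantCoeff p = 0) (hq : MvPolynomial.constantCoeff q = 0) (l l' : κ) :
    MvPolynomial.coeff (Finsupp.single l 1 + Finsupp.single l' 1) (p * q) =
      MvPolynomial.coeff (Finsupp.single l 1) p * MvPolynomial.coeff (Finsupp.single l' 1) q +
      if l = l' then 0 else
        MvPolynomial.coeff (Finsupp.single l' 1) p * MvPolynomial.coeff (Finsupp.single l 1) q := by
  rw [MvPolynomial.constantCoeff_eq] at hp hq
  rw [MvPolynomial.coeff_mul, ← Finset.sum_subset (s₁ := {(Finsupp.single l 1, Finsupp.single l' 1),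
    (Finsupp.single l' 1, Finsupp.single l 1)})]
  · by_cases h : l = l'
    · subst h
      simp
    · rw [Finset.sum_insert, Finset.sum_singleton, if_neg h]
      rw [Finset.mem_singleton, Prod.mk.injEq, not_and]
      intro h'
      exact absurd (Finsupp.single_left_injective one_ne_zero h') h
  · intro x hx
    rw [Finset.HasAntidiagonal.mem_antidiagonal]
    obtain rfl | hx := Finset.mem_insert.1 hx
    · rfl
    · rw [Finset.mem_singleton.1 hx]
      exact add_comm _ _
  · rintro ⟨a, c⟩ hac hn
    rw [Finset.HasAntidiagonal.mem_antidiagonal] at hac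
    simp only at hac
    by_cases ha : a = 0
    · simp [ha, hp]
    by_cases hc : c = 0
    · simp [hc, hq]
    exfalso
    have hdeg := congrArg Finsupp.degree hac
    rw [map_add, map_add, Finsupp.degree_single, Finsupp.degree_single] at hdeg
    have ha' := (Finsupp.degree_eq_zero_iff a).not.2 ha
    have hc' := (Finsupp.degree_eq_zero_iff c).not.2 hc
    obtain ⟨i, rfl⟩ := Finsupp.range_single_one.ge (show a.degree = 1 by omega)
    have hi : i = l ∨ i = l' := by
      by_contra! h
      have := DFunLike.congr_fun hac i
      simp [h.1.symm, h.2.symm] at this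
    rcases hi with rfl | rfl
    · exact hn (by simp [add_left_cancel hac])
    · rw [add_comm (Finsupp.single l 1)] at hac
      exact hn (by simp [add_left_cancel hac])

/-- The matrix of coefficients of a variable in a matrix of polynomials. -/
noncomputable def linearPart {m n : Type*} (l : κ) (Ψ : Matrix m n (MvPolynomial κ k)) :
    Matrix m n k :=
  Ψ.map (MvPolynomial.coeff (Finsupp.single l 1))

/-- The quadratic coefficients of `Ψ * Ψ` encode both relations at once: square zero for `l = l'`,
anticommutation otherwise. -/
theorem linearPart_mul {n : Type*} [Fintype n] (Ψ : Matrix n n (MvPolynomial κ k))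
    (h0 : ∀ i j, MvPolynomial.constantCoeff (Ψ i j) = 0) (hsq : Ψ * Ψ = 0) (l l' : κ) :
    linearPart l Ψ * linearPart l' Ψ +
      (if l = l' then 0 else linearPart l' Ψ * linearPart l Ψ) = 0 := by
  ext i j
  have h : MvPolynomial.coeff (Finsupp.single l 1 + Finsupp.single l' 1) ((Ψ * Ψ) i j) = 0 := by
    rw [hsq]
    simp
  rw [Matrix.mul_apply, MvPolynomial.coeff_sum] at h
  simp only [coeff_mul_of_constantCoeff_eq_zero _ _ (h0 _ _) (h0 _ _), Finset.sum_add_distrib] at h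
  refine Eq.trans ?_ h
  split_ifs <;> simp [linearPart, Matrix.mul_apply]

end QuadraticPart

/-! ### Change of basis and strict triangularity of the differential. -/

section BaseChange

variable {k : Type*} [Field k] {κ : Type*} {M : Type*} [AddCommGroup M]
  [Module (MvPolynomial κ k) M] {ι : Type*} [Fintype ι]

/-- An invertible change of coordinates with coefficients in `k`. -/
theorem exists_basis_of_basis_field [DecidableEq ι] (b : Module.Basis ι (MvPolynomial κ k) M)
    (v : Module.Basis ι k (ι → k)) :
    ∃ b' : Module.Basis ι (MvPolynomial κ k) M,
      ∀ i, b' i = ∑ s, (MvPolynomial.C (v i s) : MvPolynomial κ k) • b s := by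
  set w : ι → M := fun i => ∑ s, (MvPolynomial.C (v i s) : MvPolynomial κ k) • b s with hw
  have hdet : IsUnit (b.det w) := by
    have h1 : b.toMatrix w = ((Pi.basisFun k ι).toMatrix v).map MvPolynomial.C := by
      ext1 i j
      simp [Module.Basis.toMatrix_apply, hw, Finsupp.single_apply]
    have h2 : IsUnit ((Pi.basisFun k ι).det v) :=
      (Pi.basisFun k ι).is_basis_iff_det.1 ⟨v.linearIndependent, v.span_eq⟩
    rw [Module.Basis.det_apply] at h2 ⊢
    rw [h1]
    have := h2.map (MvPolynomial.C : k →+* MvPolynomial κ k)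
    rwa [RingHom.map_det] at this
  obtain ⟨h1, h2⟩ := b.is_basis_iff_det.2 hdet
  exact ⟨Module.Basis.mk h1 h2.ge, fun i => by rw [Module.Basis.mk_apply]⟩

end BaseChange

namespace DGModule

variable {k : Type u} [Field k] {r : ℕ} {M : Type v} [AddCommGroup M] [Module (PolyAlg k r) M]

/-- The matrix of the differential in a basis, acting on row vectors. -/
noncomputable def diffMatrix (D : DGModule (polyGrading k r) M) {ι : Type*}
    (b : Module.Basis ι (PolyAlg k r) M) : Matrix ι ι (PolyAlg k r) :=
  Matrix.of fun i j => b.repr (D.diff (b i)) j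

theorem repr_diff (D : DGModule (polyGrading k r) M) {ι : Type*} [Fintype ι]
    (b : Module.Basis ι (PolyAlg k r) M) (x : M) (j : ι) :
    b.repr (D.diff x) j = ∑ i, b.repr x i * D.diffMatrix b i j := by
  conv_lhs => rw [← b.sum_repr x]
  simp only [map_sum, map_smul, Finsupp.coe_finsetSum, Finset.sum_apply, Finsupp.smul_apply,
    smul_eq_mul, diffMatrix, Matrix.of_apply]

theorem diffMatrix_mul_self (D : DGModule (polyGrading k r) M) {ι : Type*} [Fintype ι]
    (b : Module.Basis ι (PolyAlg k r) M) : D.diffMatrix b * D.diffMatrix b = 0 := by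
  ext1 i j
  rw [Matrix.mul_apply]
  exact (D.repr_diff b _ j).symm.trans (by rw [D.diff_diff]; simp)

/-- If the differential has no unit coefficients, it is strictly upper triangular in some
homogeneous basis ordered by degree. -/
theorem exists_strictUpper_basis (D : DGModule (polyGrading k r) M) {N : ℕ}
    (b : Module.Basis (Fin N) (PolyAlg k r) M) (δ : Fin N → ℤ) (hb : ∀ i, b i ∈ D.piece (δ i))
    (h0 : ∀ (b : Module.Basis (Fin N) (PolyAlg k r) M) (δ : Fin N → ℤ),
      (∀ i, b i ∈ D.piece (δ i)) → ∀ i j, MvPolynomial.constantCoeff (D.diffMatrix b i j) = 0) :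
    ∃ (b' : Module.Basis (Fin N) (PolyAlg k r) M) (δ' : Fin N → ℤ), Monotone δ' ∧
      (∀ i, b' i ∈ D.piece (δ' i)) ∧ ∀ i j, j ≤ i → D.diffMatrix b' i j = 0 := by
  set Ψ := D.diffMatrix b with hΨ
  have hdeg : ∀ i j, Ψ i j ∈ polyGrading k r (δ i - 1 - δ j) := fun i j =>
    D.repr_mem b δ hb (D.diff_mem (hb i)) j
  have hmul := linearPart_mul Ψ (h0 b δ hb) (D.diffMatrix_mul_self b)
  let T : Fin r → (Fin N → k) →ₗ[k] (Fin N → k) := fun l => (linearPart l Ψ).vecMulLinear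
  have hT : ∀ l v, T l v = Matrix.vecMul v (linearPart l Ψ) := fun l v => rfl
  let Vg : ℤ → Submodule k (Fin N → k) := fun e =>
    { carrier := {v | ∀ s, δ s ≠ e → v s = 0}
      zero_mem' := by simp
      add_mem' := fun {v w} hv hw s hs => by simp [hv s hs, hw s hs]
      smul_mem' := fun c v hv s hs => by simp [hv s hs] }
  have hVg : ∀ e v, v ∈ Vg e ↔ ∀ s, δ s ≠ e → v s = 0 := fun e v => Iff.rfl
  obtain ⟨v, δ', hmono, hv, hTv⟩ := exists_homogeneous_triangular_basis T
    (fun l v => by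
      rw [hT, hT, Matrix.vecMul_vecMul]
      have := hmul l l
      rw [if_pos rfl, add_zero] at this
      rw [this, Matrix.vecMul_zero])
    (fun l l' v h => by
      rw [hT, hT, hT, hT, Matrix.vecMul_vecMul, Matrix.vecMul_vecMul, ← Matrix.vecMul_neg]
      have := hmul l l'
      rw [if_neg h] at this
      rw [eq_neg_of_add_eq_zero_right this])
    Vg
    (by
      refine top_le_iff.1 fun v _ => ?_
      rw [← Finset.univ_sum_single v]
      refine Submodule.sum_mem _ fun s _ => Submodule.mem_iSup_of_mem (δ s) ?_
      rw [hVg]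
      intro t ht
      refine Pi.single_eq_of_ne ?_ _
      rintro rfl
      exact ht rfl)
    (by
      obtain ⟨E, hE⟩ := (Set.finite_range δ).bddAbove
      refine ⟨E, fun e he => ?_⟩
      by_contra! h
      refine he ((Submodule.eq_bot_iff _).2 fun v hv => funext fun s => hv s ?_)
      exact ((hE ⟨s, rfl⟩).trans_lt h).ne)
    (by
      intro l e v hv s hs
      rw [hT, Matrix.vecMul, dotProduct]
      refine Finset.sum_eq_zero fun t _ => ?_
      by_cases ht : δ t = e
      -- A linear entry has degree `-1`, as the variables do, so it can only join basis vectors of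
      -- equal degree.
      · have : linearPart l Ψ t s = 0 := by
          refine MvPolynomial.IsWeightedHomogeneous.coeff_eq_zero (hdeg t s) _ ?_
          rw [weight_neg_one, Finsupp.degree_single]
          push_cast
          omega
        rw [this, mul_zero]
      · rw [hv t ht, zero_mul])
  revert v δ'
  rw [Module.finrank_fin_fun]
  intro v δ' hmono hv hTv
  obtain ⟨b', hb'⟩ := exists_basis_of_basis_field b v
  have hb'mem : ∀ i, b' i ∈ D.piece (δ' i) := by
    intro i
    rw [hb']
    refine sum_mem fun s _ => ?_
    by_cases hs : δ s = δ' i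
    · have := D.smul_mem (a := MvPolynomial.C (v i s)) (i := 0)
        (MvPolynomial.isWeightedHomogeneous_C _ _) (hb s)
      rwa [zero_add, hs] at this
    · rw [hv i s hs, map_zero, zero_smul]
      exact zero_mem _
  refine ⟨b', δ', hmono, hb'mem, fun i j hji => ?_⟩
  have hrepr : ∀ (x : M) l, (fun s => MvPolynomial.coeff (Finsupp.single l 1) (b.repr x s)) =
      ∑ j, MvPolynomial.coeff (Finsupp.single l 1) (b'.repr x j) • v j := by
    intro x l
    ext s
    conv_lhs => rw [← b'.sum_repr x]
    simp [hb', MvPolynomial.coeff_sum, Finsupp.single_apply, mul_comm _ (MvPolynomial.C _),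
      mul_comm _ (v _ s)]
  -- As the change of basis has scalar coefficients, it conjugates linear parts: the linear part in
  -- `b'` is the matrix of `T l` in the basis `v`.
  have hTrepr : ∀ l i, T l (v i) =
      ∑ j, MvPolynomial.coeff (Finsupp.single l 1) (D.diffMatrix b' i j) • v j := by
    intro l i
    refine Eq.trans ?_ (hrepr (D.diff (b' i)) l)
    ext s
    rw [D.repr_diff b, MvPolynomial.coeff_sum, hT, Matrix.vecMul, dotProduct]
    refine Finset.sum_congr rfl fun t _ => ?_
    have : b.repr (b' i) t = MvPolynomial.C (v i t) := by
      simp [hb', Finsupp.single_apply]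
    rw [this, MvPolynomial.coeff_C_mul]
    rfl
  have hlin : ∀ l, MvPolynomial.coeff (Finsupp.single l 1) (D.diffMatrix b' i j) = 0 := by
    intro l
    have h1 := v.repr_sum_self fun j =>
      MvPolynomial.coeff (Finsupp.single l 1) (D.diffMatrix b' i j)
    rw [← hTrepr] at h1
    have h2 := v.mem_span_image.1 (hTv l i)
    rw [← congrFun h1 j]
    by_contra hne
    exact absurd (h2 (Finsupp.mem_support_iff.2 hne)) (not_lt.2 hji)
  ext m
  rw [MvPolynomial.coeff_zero]
  by_contra hne
  have hw := D.repr_mem b' δ' hb'mem (D.diff_mem (hb'mem i)) j hne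
  rw [weight_neg_one] at hw
  have := hmono hji
  -- The degree is `δ' j - δ' i + 1`, at most 1 because `δ'` is monotone and `j ≤ i`.
  have hm : m.degree = 0 ∨ m.degree = 1 := by omega
  rcases hm with hm | hm
  · rw [Finsupp.degree_eq_zero_iff] at hm
    subst hm
    exact hne (h0 b' δ' hb'mem i j)
  · obtain ⟨l, rfl⟩ := Finsupp.range_single_one.ge hm
    exact hne (hlin l)

end DGModule

end RankConjecture

namespace RankConjecture

/-! ### Null-homotopies and the rank of contractible matrices. -/

section Homotopy

/-- If `f` annihilates the homology of a strictly triangular differential, a power of `f` is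
null-homotopic. -/
theorem exists_homotopy {R : Type*} [CommRing R] {M : Type*} [AddCommGroup M] [Module R M]
    {N : ℕ} (b : Module.Basis (Fin N) R M) (d : M →ₗ[R] M) (hdd : ∀ x, d (d x) = 0)
    (htri : ∀ i j, j ≤ i → b.repr (d (b i)) j = 0) (f : R)
    (hf : ∀ z, d z = 0 → ∃ w, d w = f • z) :
    ∃ h : M →ₗ[R] M, ∀ x, d (h x) + h (d x) = f ^ N • x := by
  -- Induction on the number `p` of trailing basis vectors on which the homotopy identity holds;
  -- each further vector costs one factor `f`.
  suffices H : ∀ p : ℕ, ∃ h : M →ₗ[R] M, ∀ i : Fin N, N ≤ i + p →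
      d (h (b i)) + h (d (b i)) = f ^ p • b i by
    obtain ⟨h, hh⟩ := H N
    refine ⟨h, fun x => ?_⟩
    have : d ∘ₗ h + h ∘ₗ d = f ^ N • LinearMap.id := b.ext fun i => by
      simpa using hh i (by omega)
    exact LinearMap.congr_fun this x
  intro p
  induction p with
  | zero => exact ⟨0, fun i hi => absurd i.2 (by omega)⟩
  | succ p ih =>
    obtain ⟨h, hh⟩ := ih
    by_cases hp : p < N
    · let i₀ : Fin N := ⟨N - p - 1, by omega⟩
      have hexp : ∀ i, d (b i) = ∑ j, b.repr (d (b i)) j • b j := fun i =>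
        (b.sum_repr (d (b i))).symm
      -- Triangularity puts `d (b i₀)` in the span of later vectors, where `h` already works.
      have hcycle : d (f ^ p • b i₀ - h (d (b i₀))) = 0 := by
        have h1 : d (h (d (b i₀))) + h (d (d (b i₀))) = f ^ p • d (b i₀) := by
          rw [hexp i₀]
          simp only [map_sum, map_smul, ← Finset.sum_add_distrib, Finset.smul_sum, ← smul_add]
          refine Finset.sum_congr rfl fun j _ => ?_
          by_cases hj : j ≤ i₀
          · rw [htri _ _ hj]
            simp
          · have hj' : N - p - 1 < (j : ℕ) := not_le.1 hj
            rw [hh j (by omega), smul_comm]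
        rw [hdd, map_zero, add_zero] at h1
        rw [map_sub, map_smul, h1, sub_self]
      obtain ⟨w, hw⟩ := hf _ hcycle
      -- The new value `w` bounds `f` times the cycle; the old values are rescaled by `f` to match
      -- the new power.
      let h' : M →ₗ[R] M := b.constr R fun i => if i = i₀ then w else f • h (b i)
      have hb : ∀ i, h' (b i) = if i = i₀ then w else f • h (b i) := fun i => b.constr_basis R _ i
      have hd : ∀ i, i₀ ≤ i → h' (d (b i)) = f • h (d (b i)) := by
        intro i hi
        rw [hexp i]
        simp only [map_sum, map_smul, Finset.smul_sum]
        refine Finset.sum_congr rfl fun j _ => ?_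
        by_cases hj : j ≤ i
        · rw [htri _ _ hj]
          simp
        · rw [hb, if_neg (by rintro rfl; exact hj hi), smul_comm]
      refine ⟨h', fun i hi => ?_⟩
      have hi₀ : i₀ ≤ i := Fin.le_def.2 (by simp only [i₀]; omega)
      rw [hd i hi₀, hb]
      by_cases h : i = i₀
      · subst h
        rw [if_pos rfl, hw, pow_succ', smul_sub, mul_smul, sub_add_cancel]
      · have : N ≤ i + p := by
          have := Fin.lt_def.1 (lt_of_le_of_ne hi₀ (Ne.symm h))
          simp only [i₀] at this
          omega
        rw [if_neg h, map_smul, ← smul_add, hh i this, pow_succ', mul_smul]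
    · refine ⟨f • h, fun i _ => ?_⟩
      rw [LinearMap.smul_apply, LinearMap.smul_apply, map_smul, ← smul_add, hh i (by omega),
        pow_succ', mul_smul]

/-- A contractible square-zero matrix has rank half its size. -/
theorem two_mul_rank_of_contractible {K ι : Type*} [Field K] [Fintype ι] [DecidableEq ι]
    (X Y : Matrix ι ι K) (hX : X * X = 0) (c : K) (hc : c ≠ 0) (h : Y * X + X * Y = c • 1) :
    2 * X.rank = Fintype.card ι := by
  refine le_antisymm ?_ ?_
  · rw [two_mul]
    exact Matrix.rank_add_rank_le_card_of_mul_eq_zero hX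
  -- On a kernel vector the contraction reads `X Y v = c v`, so the kernel lies in the range.
  · have hle : LinearMap.ker X.mulVecLin ≤ LinearMap.range X.mulVecLin := by
      intro v hv
      rw [LinearMap.mem_ker, Matrix.mulVecLin_apply] at hv
      have := congrArg (fun Z => Z.mulVec v) h
      simp only [Matrix.add_mulVec, ← Matrix.mulVec_mulVec, hv, Matrix.mulVec_zero, zero_add,
        Matrix.smul_mulVec, Matrix.one_mulVec] at this
      refine ⟨c⁻¹ • Y.mulVec v, ?_⟩
      rw [map_smul, Matrix.mulVecLin_apply, this, inv_smul_smul₀ hc]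
    have h1 := Submodule.finrank_mono hle
    have h2 := X.mulVecLin.finrank_range_add_finrank_ker
    rw [Module.finrank_fintype_fun_eq_card] at h2
    rw [Matrix.rank]
    omega

end Homotopy

/-- Multiplication by `a` is an endomorphism of a finite dimensional space, hence integral over `k`.
-/
theorem exists_monic_aeval_smul_eq_zero {k A V : Type*} [Field k] [CommRing A] [Algebra k A]
    [AddCommGroup V] [Module k V] [Module A V] [IsScalarTower k A V] [Module.Finite k V] (a : A) :
    ∃ q : Polynomial k, q.Monic ∧ ∀ v : V, Polynomial.aeval a q • v = 0 := by
  obtain ⟨q, hq, hq0⟩ := (Algebra.IsIntegral.of_finite k (Module.End k V)).isIntegral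
    (Algebra.lsmul k k V a)
  rw [← Polynomial.aeval_def, Polynomial.aeval_algHom_apply] at hq0
  exact ⟨q, hq, LinearMap.congr_fun hq0⟩

/-! ### Finite dimensional homology and the rank at nonzero points. -/

namespace DGModule

variable {k : Type u} [Field k] {r : ℕ} {M : Type v} [AddCommGroup M] [Module (PolyAlg k r) M]

/-- Powers of the variables annihilate finite dimensional homology. -/
theorem exists_pow_smul_mem_range (D : DGModule (polyGrading k r) M)
    (hD : HasNonzeroFiniteHomology D) (l : Fin r) :
    ∃ s : ℕ, ∀ z, D.diff z = 0 → ∃ w, D.diff w = (MvPolynomial.X l : PolyAlg k r) ^ s • z := by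
  let _ : Module k D.Homology := Module.compHom _ (algebraMap k (PolyAlg k r))
  have : IsScalarTower k (PolyAlg k r) D.Homology := IsScalarTower.of_algebraMap_smul fun _ _ => rfl
  have : Module.Finite k D.Homology := hD.2
  obtain ⟨q, hq, hq0⟩ :=
    exists_monic_aeval_smul_eq_zero (k := k) (V := D.Homology) (MvPolynomial.X l : PolyAlg k r)
  set a : PolyAlg k r := Polynomial.aeval (MvPolynomial.X l) q with ha
  have hkill : ∀ z, D.diff z = 0 → ∃ w, D.diff w = a • z := by
    intro z hz
    have h1 : a • (Submodule.Quotient.mk ⟨z, hz⟩ : D.Homology) = 0 :=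
      hq0 _
    rw [← Submodule.Quotient.mk_smul, homology_mk_eq_zero_iff] at h1
    exact h1
  -- Since `q` is monic, its leading term is a homogeneous component of `a`; taking components below
  -- replaces `a` by this pure power.
  have hcomp : polyComp k r (-(q.natDegree : ℤ)) a = MvPolynomial.X l ^ q.natDegree := by
    have hX : ∀ i : ℕ, (MvPolynomial.X l ^ i : PolyAlg k r) ∈ polyGrading k r (-(i : ℤ)) := by
      intro i
      have := (MvPolynomial.isWeightedHomogeneous_X k (fun _ : Fin r => (-1 : ℤ)) l).pow i
      simpa using this
    rw [ha, Polynomial.aeval_eq_sum_range, map_sum, Finset.sum_eq_single q.natDegree]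
    · rw [map_smul, hq.coeff_natDegree, one_smul, polyComp,
        MvPolynomial.weightedHomogeneousComponent_of_mem (hX _), if_pos rfl]
    · intro i _ hi
      rw [map_smul, polyComp,
        MvPolynomial.weightedHomogeneousComponent_of_mem (hX _), if_neg (by omega), smul_zero]
    · simp
  refine ⟨q.natDegree, fun z hz => ?_⟩
  refine D.of_comp (P := fun z => ∃ w, D.diff w = (MvPolynomial.X l : PolyAlg k r) ^ q.natDegree • z)
    ⟨0, by simp⟩ ?_ z fun t => ?_
  · rintro x y ⟨v, hv⟩ ⟨w, hw⟩
    exact ⟨v + w, by rw [map_add, hv, hw, smul_add]⟩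
  · obtain ⟨w, hw⟩ := hkill (D.comp t z) (by rw [← D.comp_diff, hz, map_zero])
    -- The power lowers degree by `q.natDegree`, and the `+ 1` offsets the degree of the
    -- differential.
    refine ⟨D.comp (t - q.natDegree + 1) w, ?_⟩
    rw [← D.comp_diff, hw, D.comp_smul _ _ (D.comp_mem t z), ← hcomp,
      show t - q.natDegree + 1 - 1 - t = -(q.natDegree : ℤ) by ring]

/-- The evaluations of a strictly triangular matrix of the differential away from the origin have
rank half their size. -/
theorem two_mul_rank_diffMatrix (D : DGModule (polyGrading k r) M)
    (hD : HasNonzeroFiniteHomology D) {N : ℕ} (b : Module.Basis (Fin N) (PolyAlg k r) M)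
    (htri : ∀ i j, j ≤ i → D.diffMatrix b i j = 0) (γ : Fin r → k) (hγ : γ ≠ 0) :
    2 * ((D.diffMatrix b).map (MvPolynomial.eval γ)).rank = N := by
  obtain ⟨l, hl⟩ := Function.ne_iff.1 hγ
  obtain ⟨s, hs⟩ := D.exists_pow_smul_mem_range hD l
  obtain ⟨h, hh⟩ := exists_homotopy b D.diff D.diff_diff htri _ hs
  let H : Matrix (Fin N) (Fin N) (PolyAlg k r) := Matrix.of fun i j => b.repr (h (b i)) j
  -- Matrices act on rows here, so composition reverses: `H * D.diffMatrix b` is `h` followed by the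
  -- differential.
  have hmat : H * D.diffMatrix b + D.diffMatrix b * H =
      ((MvPolynomial.X l : PolyAlg k r) ^ s) ^ N • 1 := by
    ext1 i j
    have h1 := congrArg (fun x => b.repr x j) (hh (b i))
    simp only [map_add, Finsupp.add_apply, map_smul, Finsupp.smul_apply, D.repr_diff b] at h1
    have h2 : b.repr (h (D.diff (b i))) j = ∑ t, D.diffMatrix b i t * H t j := by
      conv_lhs => rw [← b.sum_repr (D.diff (b i))]
      simp only [map_sum, map_smul, Finsupp.coe_finsetSum, Finset.sum_apply, Finsupp.smul_apply,
        smul_eq_mul]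
      rfl
    rw [h2] at h1
    refine h1.trans ?_
    rw [b.repr_self, Matrix.smul_apply, Matrix.one_apply, Finsupp.single_apply]
  have hev := congrArg (fun Z => Z.map (MvPolynomial.eval γ)) hmat
  simp only [Matrix.map_add _ (map_add (MvPolynomial.eval γ)), Matrix.map_mul] at hev
  refine (two_mul_rank_of_contractible _ (H.map (MvPolynomial.eval γ)) ?_ ((γ l ^ s) ^ N)
    (pow_ne_zero _ (pow_ne_zero _ hl)) (hev.trans ?_)).trans (Fintype.card_fin N)
  · rw [← Matrix.map_mul, D.diffMatrix_mul_self, Matrix.map_zero _ (map_zero _)]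
  · ext i j
    by_cases h : i = j <;> simp [h]

end DGModule

end RankConjecture

namespace RankConjecture

/-! ### The morphism defined by a triangular matrix of polynomials. -/

section Morphism

variable {k : Type u} [Field k] {r n : ℕ}

theorem eval_smul_of_isWeightedHomogeneous {p : MvPolynomial (Fin r) k} {e : ℤ}
    (hp : MvPolynomial.IsWeightedHomogeneous (fun _ : Fin r => (1 : ℤ)) p e) (c : kˣ)
    (γ : Fin r → k) :
    MvPolynomial.eval ((c : k) • γ) p = ((c ^ e : kˣ) : k) * MvPolynomial.eval γ p := by
  rw [MvPolynomial.eval_eq, MvPolynomial.eval_eq, Finset.mul_sum]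
  refine Finset.sum_congr rfl fun m hm => ?_
  have hw := hp (MvPolynomial.mem_support_iff.1 hm)
  rw [← hw]
  simp only [Finsupp.weight_apply, Pi.smul_apply, smul_eq_mul, mul_pow, Finset.prod_mul_distrib,
    Finset.prod_pow_eq_pow_sum, nsmul_eq_mul, mul_one, Finsupp.sum]
  rw [← Nat.cast_sum, zpow_natCast, Units.val_pow_eq_pow_val]
  ring

/-- The rank of a matrix is constant on the orbits of the weighted action. -/
theorem rank_le_of_weightedSetoid {N : ℕ} {d : Fin N → ℤ} {X Y : PuncturedU k N}
    (h : (weightedSetoid d).r X Y) : Y.1.rank ≤ X.1.rank := by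
  obtain ⟨c, hc⟩ := h
  -- The weight splits as `(d i + 1) + (-d j)`, so the action is multiplication by diagonal matrices
  -- on both sides.
  have : Y.1 = Matrix.diagonal (fun i => ((c ^ (d i + 1) : kˣ) : k)) * X.1 *
      Matrix.diagonal (fun j => ((c ^ (-d j) : kˣ) : k)) := by
    ext i j
    rw [Matrix.mul_diagonal, Matrix.diagonal_mul, hc, mul_right_comm, ← Units.val_mul, ← zpow_add]
    congr 3
    ring
  rw [this]
  exact (Matrix.rank_mul_le_left _ _).trans (Matrix.rank_mul_le_right _ _)

/-- A strictly upper triangular square-zero matrix of homogeneous polynomials whose values away from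
the origin have rank `n` represents a nonconstant morphism to `V(d) - L(d)`. -/
theorem exists_nonconstant_morphism (hn : 0 < n) (d : Fin (2 * n) → ℤ)
    (Ψ : Matrix (Fin (2 * n)) (Fin (2 * n)) (MvPolynomial (Fin r) k))
    (htri : ∀ i j, j ≤ i → Ψ i j = 0)
    (hhom : ∀ i j, i < j →
      MvPolynomial.IsWeightedHomogeneous (fun _ : Fin r => (1 : ℤ)) (Ψ i j) (d i - d j + 1))
    (hsq : Ψ * Ψ = 0) (hrank : ∀ γ : Fin r → k, γ ≠ 0 → (Ψ.map (MvPolynomial.eval γ)).rank = n) :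
    ∃ ψ : Projectivization k (Fin r → k) → WeightedU k d,
      IsNonconstantMorphism d (varV k d \ varL k d) ψ ∧ Represents d 1 Ψ ψ := by
  have htri' : ∀ γ i j, j ≤ i → Ψ.map (MvPolynomial.eval γ) i j = 0 := by
    intro γ i j hij
    rw [Matrix.map_apply, htri i j hij, map_zero]
  have hne : ∀ γ : Fin r → k, γ ≠ 0 → Ψ.map (MvPolynomial.eval γ) ≠ 0 := by
    intro γ hγ h
    have := hrank γ hγ
    rw [h, Matrix.rank_zero] at this
    omega
  let P : ∀ γ : Fin r → k, γ ≠ 0 → PuncturedU k (2 * n) := fun γ hγ =>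
    ⟨Ψ.map (MvPolynomial.eval γ), htri' γ, hne γ hγ⟩
  let ψ : Projectivization k (Fin r → k) → WeightedU k d := fun x =>
    Quotient.mk (weightedSetoid d) (P x.rep x.rep_nonzero)
  -- Rescaling `γ` moves the matrix along its weighted orbit, by homogeneity, so the chosen
  -- representative does not matter.
  have hψ : ∀ γ hγ, ψ (Projectivization.mk k γ hγ) = Quotient.mk (weightedSetoid d) (P γ hγ) := by
    intro γ hγ
    obtain ⟨c, hc⟩ := (Projectivization.mk_eq_mk_iff k _ _ (Projectivization.rep_nonzero _) hγ).1
      (Projectivization.mk_rep (Projectivization.mk k γ hγ))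
    refine Quotient.sound ((weightedSetoid d).symm ⟨c, fun i j => ?_⟩)
    change MvPolynomial.eval _ (Ψ i j) = _ * MvPolynomial.eval γ (Ψ i j)
    obtain hij | hij := le_or_gt j i
    · rw [htri i j hij, map_zero, map_zero, mul_zero]
    · rw [← eval_smul_of_isWeightedHomogeneous (hhom i j hij), ← hc]
      rfl
  have hrep : Represents d 1 Ψ ψ :=
    { strictUpper := htri
      homogeneous := fun i j hij => by simpa using hhom i j hij
      nonvanishing := fun γ hγ => by
        by_contra! h
        refine hne γ hγ (Matrix.ext fun i j => ?_)
        obtain hij | hij := le_or_gt j i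
        · exact htri' γ i j hij
        · exact h i j hij
      value := fun γ hγ => ⟨⟨htri' γ, hne γ hγ⟩, hψ γ hγ⟩ }
  refine ⟨ψ, ⟨fun x => ⟨⟨P x.rep x.rep_nonzero, ?_, rfl⟩, ?_⟩, 1, Ψ, one_pos, hrep⟩, hrep⟩
  · change Ψ.map (MvPolynomial.eval _) * Ψ.map (MvPolynomial.eval _) = 0
    rw [← Matrix.map_mul, hsq, Matrix.map_zero _ (map_zero _)]
  · rintro ⟨Y, -, hYr, hY⟩
    have h := rank_le_of_weightedSetoid ((weightedSetoid d).symm (Quotient.exact hY))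
    have hx : (P x.rep x.rep_nonzero).1.rank = n := hrank _ x.rep_nonzero
    omega

end Morphism

/-! ### Modules of smallest rank and the two conjectures. -/

/-- The structure of the free `DG`-modules of smallest rank. -/
theorem structure_of_smallest_rank {k : Type u} [Field k] {r : ℕ} (hr : 0 < r)
    {M : Type v} [AddCommGroup M] [Module (PolyAlg k r) M] [Module.Free (PolyAlg k r) M]
    (D : DGModule (polyGrading k r) M) (hD : HasNonzeroFiniteHomology D)
    (hmin : IsSmallestRank.{u, v} k r (Module.finrank (PolyAlg k r) M)) :
    LinearMap.range D.diff ≤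
        Ideal.span (Set.range (MvPolynomial.X : Fin r → PolyAlg k r)) •
          (⊤ : Submodule (PolyAlg k r) M) ∧
      ∃ n : ℕ, 0 < n ∧ Module.finrank (PolyAlg k r) M = 2 * n ∧
        ∃ (b : Module.Basis (Fin (2 * n)) (PolyAlg k r) M) (d : Fin (2 * n) → ℤ)
          (Ψ : Matrix (Fin (2 * n)) (Fin (2 * n)) (PolyAlg k r)),
          Antitone d ∧ (∀ i, b i ∈ D.piece (-d i)) ∧
          (∀ i, D.diff (b i) = ∑ j, Ψ i j • b j) ∧
          (∀ i j, j ≤ i → Ψ i j = 0) ∧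
          (∀ γ : Fin r → k, γ ≠ 0 → (Ψ.map (MvPolynomial.eval γ)).rank = n) ∧
          ∃ ψ : Projectivization k (Fin r → k) → WeightedU k d,
            IsNonconstantMorphism d (varV k d \ varL k d) ψ ∧ Represents d 1 Ψ ψ := by
  have hpos : 0 < Module.finrank (PolyAlg k r) M := hmin.1.1
  have : Module.Finite (PolyAlg k r) M := Module.finite_of_finrank_pos hpos
  obtain ⟨b₀, δ₀, hb₀⟩ := D.exists_homogeneous_basis
  have h0 := D.constantCoeff_repr_diff_eq_zero hD hmin
  obtain ⟨b, δ, hmono, hb, htri⟩ := D.exists_strictUpper_basis b₀ δ₀ hb₀ h0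
  refine ⟨?_, ?_⟩
  · rintro _ ⟨x, rfl⟩
    rw [← b₀.sum_repr (D.diff x)]
    refine Submodule.sum_mem _ fun j _ => Submodule.smul_mem_smul ?_ trivial
    rw [mem_span_X_iff, D.repr_diff b₀, map_sum]
    refine Finset.sum_eq_zero fun i _ => ?_
    rw [map_mul, DGModule.diffMatrix, Matrix.of_apply, h0 b₀ δ₀ hb₀, mul_zero]
  · have hrank := D.two_mul_rank_diffMatrix hD b htri
    -- Evenness is read off at the all-ones point, which is nonzero because `r` is positive.
    obtain ⟨n, hn⟩ : ∃ n, Module.finrank (PolyAlg k r) M = 2 * n :=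
      ⟨_, (hrank (fun _ => 1) (fun h => one_ne_zero (congrFun h ⟨0, hr⟩))).symm⟩
    revert b δ
    rw [hn]
    intro b δ hmono hb htri hrank
    have hrank' : ∀ γ : Fin r → k, γ ≠ 0 →
        ((D.diffMatrix b).map (MvPolynomial.eval γ)).rank = n := fun γ hγ => by
      have := hrank γ hγ
      omega
    refine ⟨n, by omega, rfl, b, fun i => -δ i, D.diffMatrix b, fun i j h => neg_le_neg (hmono h),
      fun i => by simpa using hb i, fun i => (b.sum_repr _).symm, htri, hrank',
      exists_nonconstant_morphism (by omega) _ _ htri (fun i j _ m hm => ?_)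
        (D.diffMatrix_mul_self b) hrank'⟩
    have hw := D.repr_mem b δ hb (D.diff_mem (hb i)) j hm
    rw [weight_neg_one] at hw
    have h1 : Finsupp.weight (fun _ : Fin r => (1 : ℤ)) m = m.degree := by
      simp [Finsupp.weight_apply, Finsupp.sum, Finsupp.degree_apply]
    rw [h1]
    omega

end RankConjecture

open RankConjecture in
theorem theorem2p1 (k : Type u) [Field k] [IsAlgClosed k] (r : ℕ) :
    -- the conjecture on square-zero matrices implies the rank conjecture
    (∀ N : ℕ, (∀ n : ℕ, 0 < n → 2 * n ≤ N → SquareZeroMatrixConjecture k r n) →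
      CarlssonRankConjecture.{u, v} k r N) ∧
    -- the structure of the free DG-modules of smallest rank
    (0 < r →
      ∀ (M : Type v) [AddCommGroup M] [Module (PolyAlg k r) M] [Module.Free (PolyAlg k r) M]
        (D : DGModule (polyGrading k r) M),
        HasNonzeroFiniteHomology D →
        IsSmallestRank.{u, v} k r (Module.finrank (PolyAlg k r) M) →
        LinearMap.range D.diff ≤
            Ideal.span (Set.range (MvPolynomial.X : Fin r → PolyAlg k r)) •
              (⊤ : Submodule (PolyAlg k r) M) ∧
          ∃ n : ℕ, 0 < n ∧ Module.finrank (PolyAlg k r) M = 2 * n ∧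
            ∃ (b : Module.Basis (Fin (2 * n)) (PolyAlg k r) M) (d : Fin (2 * n) → ℤ)
              (Ψ : Matrix (Fin (2 * n)) (Fin (2 * n)) (PolyAlg k r)),
              Antitone d ∧ (∀ i, b i ∈ D.piece (-d i)) ∧
              (∀ i, D.diff (b i) = ∑ j, Ψ i j • b j) ∧
              (∀ i j, j ≤ i → Ψ i j = 0) ∧
              (∀ γ : Fin r → k, γ ≠ 0 → (Ψ.map (MvPolynomial.eval γ)).rank = n) ∧
              ∃ ψ : Projectivization k (Fin r → k) → WeightedU k d,
                IsNonconstantMorphism d (varV k d \ varL k d) ψ ∧ Represents d 1 Ψ ψ) := by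
  have structure_smallest := fun (hr : 0 < r) (M : Type v) [AddCommGroup M]
      [Module (PolyAlg k r) M] [Module.Free (PolyAlg k r) M] (D : DGModule (polyGrading k r) M)
      (hD : HasNonzeroFiniteHomology D) => structure_of_smallest_rank hr D hD
  refine ⟨?_, structure_smallest⟩
  intro N hSZ M _ _ _ D hN hrank hD
  -- For `r = 0` the bound is `1 ≤ N`.
  obtain rfl | hr := Nat.eq_zero_or_pos r
  · exact hN
  have hmem : N ∈ {N' : ℕ | 0 < N' ∧ ∃ (M : Type v) (_ : AddCommGroup M)
      (_ : Module (PolyAlg k r) M) (D : DGModule (polyGrading k r) M),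
      Module.Free (PolyAlg k r) M ∧ Module.finrank (PolyAlg k r) M = N' ∧
      HasNonzeroFiniteHomology D} := ⟨hN, M, _, _, D, inferInstance, hrank, hD⟩
  -- The given module need not have smallest rank, so the structure result is applied to one that
  -- does; its rank is at most `N`.
  have hleast : IsSmallestRank.{u, v} k r _ := ⟨Nat.sInf_mem ⟨N, hmem⟩, fun _ h => Nat.sInf_le h⟩
  obtain ⟨-, M₀, _, _, D₀, _, hrank₀, hD₀⟩ := hleast.1
  have hle := hleast.2 hmem
  rw [← hrank₀] at hleast hle
  obtain ⟨-, n, hn, h2n, b, d, Ψ, hd, -, -, -, -, ψ, hψ, -⟩ :=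
    structure_smallest hr M₀ D₀ hD₀ hleast
  rw [h2n] at hle
  exact (hSZ n hn hle d hd ⟨ψ, hψ⟩).trans hle
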